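/- **Setting.** A moving target defense game has a finite nonempty set $S$ of system configurations, a finite set $L$ of attacker types with prior probabilities $\pi_l$, and for each type $l$ a finite nonempty set $A_l$ of attack methods. Each method $a$ and state $j$ have an attacking time $\xi_{a,j}\in[0,\infty]$ with a given law. $R^l_{a,j}$ and $C^l_{a,j}$ are the attacker's benefit and the defender's loss per unit of time, and $m_{ij}$ is the migration cost. Let $0<\underline\tau\le\overline\tau$ and let $T\subseteq[\underline\tau,\overline\tau]$ be the nonempty compact set of admissible defending periods (for example $T=[\underline\tau,\overline\tau]$, or the grid $\{\underline\tau+k\delta\le\overline\tau : k=0,1,\dots\}$ with $\delta>0$). An action at any state is a pair $x=(\mathbf p,\tau)\in U=\Delta(S)\times T$, where $\Delta(S)$ is the set of all probability vectors on $S$; thus the defender can choose any transition matrix. A stationary policy is a map $\mathbf u=(u(i))_{i\in S}$ with $u(i)=(\mathbf p_i,\tau_i)\in U$, and $P(\mathbf u)=[p_{ij}]$. The single period cost is $$c(i,(\mathbf p,\tau))=\sum_{l}\pi_l\sum_j p_j\,\mathbb E[(\tau-\xi_{a^l,j})^+]\,C^l_{a^l,j}+\sum_j p_j m_{ij},$$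 where $a^l\in A_l$ maximizes $\sum_j p_j\,\mathbb E[(\tau-\xi_{a,j})^+]R^l_{a,j}$ over $a\in A_l$, ties being broken in favor of the defender. The average cost of the semi-Markov problem (SMDP) is, with $(s_k)$ the Markov chain with transition matrix $P(\mathbf u)$, $$z(i,\mathbf u)=\liminf_{N\to\infty}\frac{\mathbb E_i\sum_{k<N}c(s_k,u(s_k))}{\mathbb E_i\sum_{k<N}\tau_{s_k}}.$$ Fix $0<\gamma<\underline\tau$. The transformed discrete-time problem (DTMDP) has costs $\tilde c(i,x)=c(i,x)/\tau$ and transition probabilities $\tilde p_{ij}(x)=\gamma(p_j-\delta_{ij})/\tau+\delta_{ij}$ for $x=(\mathbf p,\tau)$. Let $\tilde{\mathbf c}(\mathbf u)$, $\tilde P(\mathbf u)$ be the cost vector and transition matrix under $\mathbf u$. Its average cost is $\tilde z(i,\mathbf u)=\limsup_{N}\frac1N\sum_{k<N}(\tilde P(\mathbf u)^k\tilde{\mathbf c}(\mathbf u))(i)$. Put $\lambda(i)=\inf_{\mathbf u}\tilde z(i,\mathbf u)$. A stationary policy is optimal (for either problem) if it minimizes the average cost over all stationary policies for every initial state simultaneously.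 It is $\varepsilon$-optimal if the Cesàro limit $\tilde P^*=\lim_N\frac1N\sum_{k<N}\tilde P(\mathbf u)^k$ exists and $\tilde P^*\tilde{\mathbf c}(\mathbf u)\le\lambda+\varepsilon\mathbf e$, where $\mathbf e$ is the all-ones vector. Let $F(V)=\min_{\mathbf u}[\tilde{\mathbf c}(\mathbf u)+\tilde P(\mathbf u)V]$ for $V\in\mathbb R^S$, minimized for each state separately, and $\|x\|=\max_i x_i-\min_i x_i$. From an arbitrary $V^0\in\mathbb R^S$ value iteration computes $V^{t+1}=F(\kappa_tV^t)$, with $\kappa_0=\frac12$ and $\kappa_t=\frac t{t+1}$ for $t\ge1$. **Theorem.** Assume that for each $i$ the cost per unit of time $x\mapsto\tilde c(i,x)$ is continuous and bounded on $U$. Then: 1. The DTMDP has an optimal stationary policy, and hence so has the SMDP; indeed some stationary policy is optimal for both. 2. The minimum defining $F(V)$ is attained for every $V$, and for every $V^0$ and every $\varepsilon>0$: (a) if $\|F(V^t)-V^t\|<\varepsilon$, then every policy attaining the minimum in $F(V^t)$ is $\varepsilon$-optimal; (b) $\|F(V^t)-V^t\|<\varepsilon$ and $\|V^{t+1}-V^t\|<\varepsilon$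 hold for all sufficiently large $t$, so each of these conditions is met after finitely many iterations; (c) for all sufficiently large $t$, every policy attaining the minimum in the update $V^{t+1}=F(\kappa_tV^t)$ is $\varepsilon$-optimal. -/

import Mathlib

open Filter Topology MeasureTheory
open scoped ENNReal

noncomputable section

/-- The data of the moving target defense game: `S` is the set of system configurations, `L` the
set of attacker types and `Att` the set of attack methods. -/
structure MTDGame (S L Att : Type*) [Fintype L] where
  /-- the attack space of each attacker type -/
  attacks : L → Finset Att
  attacks_nonempty : ∀ l, (attacks l).Nonempty
  /-- the law of the attacking time `ξ_{a,j}`, which may take the value `∞` -/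
  attackTime : Att → S → ProbabilityMeasure ℝ≥0∞
  /-- the benefit per unit of time of the attacker -/
  R : L → Att → S → ℝ
  /-- the loss per unit of time of the defender -/
  C : L → Att → S → ℝ
  /-- the migration costs -/
  m : S → S → ℝ
  /-- the prior distribution of the attacker types -/
  prior : L → ℝ
  prior_nonneg : ∀ l, 0 ≤ prior l
  prior_sum : ∑ l, prior l = 1

/-- An action of the defender at a state: a probability vector over the next states, which can be
chosen arbitrarily, and a defending period in the set `T` of admissible periods. -/
abbrev MTDAction (S : Type*) [Fintype S] (T : Set ℝ) := stdSimplex ℝ S × T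

/-- A (deterministic) stationary policy: an action for each state. -/
abbrev MTDPolicy (S : Type*) [Fintype S] (T : Set ℝ) := S → MTDAction S T

/-- The span seminorm `max x - min x`. -/
def spanSeminorm {S : Type*} (x : S → ℝ) : ℝ := (⨆ i, x i) - ⨅ i, x i

namespace MTDGame

variable {S L Att : Type*} [Fintype S] [Fintype L] {T : Set ℝ}

/-- `E[(τ - ξ_{a,j})⁺]`; the subtraction of `ℝ≥0∞` is truncated, and `τ - ∞ = 0`. -/
def exposure (G : MTDGame S L Att) (τ : ℝ) (a : Att) (j : S) : ℝ :=
  (∫⁻ x, (ENNReal.ofReal τ - x) ∂(G.attackTime a j : Measure ℝ≥0∞)).toReal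

/-- The expected reward per period of an attacker of type `l` who uses the method `a`. -/
def attackerReward (G : MTDGame S L Att) (l : L) (x : MTDAction S T) (a : Att) : ℝ :=
  ∑ j, x.1.1 j * G.exposure x.2.1 a j * G.R l a j

/-- The expected loss per period of the defender due to the method `a` of type `l`. -/
def attackLoss (G : MTDGame S L Att) (l : L) (x : MTDAction S T) (a : Att) : ℝ :=
  ∑ j, x.1.1 j * G.exposure x.2.1 a j * G.C l a j

open Classical in
/-- The best responses of an attacker of type `l` to the action `x`. -/
def bestResponses (G : MTDGame S L Att) (l : L) (x : MTDAction S T) : Finset Att :=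
  (G.attacks l).filter fun a => ∀ b ∈ G.attacks l, G.attackerReward l x b ≤ G.attackerReward l x a

theorem bestResponses_nonempty (G : MTDGame S L Att) (l : L) (x : MTDAction S T) :
    (G.bestResponses l x).Nonempty := by
  obtain ⟨a, ha, h⟩ := (G.attacks l).exists_max_image (G.attackerReward l x) (G.attacks_nonempty l)
  exact ⟨a, by classical exact Finset.mem_filter.2 ⟨ha, h⟩⟩

/-- The expected single period cost `c(i, x)`: each attacker type plays a best response and breaks
ties in favor of the defender. -/
def cost (G : MTDGame S L Att) (i : S) (x : MTDAction S T) : ℝ :=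
  ∑ l, G.prior l * (G.bestResponses l x).inf' (G.bestResponses_nonempty l x) (G.attackLoss l x)
    + ∑ j, x.1.1 j * G.m i j

/-- The cost per unit of time `c(i, x) / τ`, the per-stage cost of the transformed problem. -/
def costRate (G : MTDGame S L Att) (i : S) (x : MTDAction S T) : ℝ := G.cost i x / x.2.1

end MTDGame

section Chains

variable {S : Type*} [Fintype S] [DecidableEq S] {T : Set ℝ}

/-- The transition matrix of the semi-Markov problem under a stationary policy. -/
def transMatrix (u : MTDPolicy S T) : Matrix S S ℝ := Matrix.of fun i j => (u i).1.1 j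

/-- The transition probability from `i` to `j` in the transformed discrete-time problem. -/
def transProb (γ : ℝ) (i : S) (x : MTDAction S T) (j : S) : ℝ :=
  γ * ((x.1.1 j - (1 : Matrix S S ℝ) i j) / x.2.1) + (1 : Matrix S S ℝ) i j

/-- The transition matrix of the transformed discrete-time problem under a stationary policy. -/
def transMatrixDT (γ : ℝ) (u : MTDPolicy S T) : Matrix S S ℝ :=
  Matrix.of fun i j => transProb γ i (u i) j

/-- `E[∑_{k < N} f(s_k) | s_0 = i]` for the Markov chain with transition matrix `P`. -/
def expectedSum (P : Matrix S S ℝ) (f : S → ℝ) (N : ℕ) (i : S) : ℝ :=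
  ∑ k ∈ Finset.range N, ((P ^ k).mulVec f) i

/-- `Q` is the Cesàro limit of the powers of `P`. -/
def IsCesaroLimit (P Q : Matrix S S ℝ) : Prop :=
  Tendsto (fun N : ℕ => (N : ℝ)⁻¹ • ∑ k ∈ Finset.range N, P ^ k) atTop (𝓝 Q)

end Chains

/-- The discount sequence `κ_0 = 1/2`, `κ_t = t/(t+1)` for `t ≥ 1`. -/
def viKappa (t : ℕ) : ℝ := if t = 0 then 1 / 2 else (t : ℝ) / (t + 1)

namespace MTDGame

variable {S L Att : Type*} [Fintype S] [DecidableEq S] [Fintype L] {T : Set ℝ}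

/-- The long-run average cost of the semi-Markov problem from the initial state `i`. -/
def avgCost (G : MTDGame S L Att) (u : MTDPolicy S T) (i : S) : ℝ :=
  liminf (fun N : ℕ => expectedSum (transMatrix u) (fun s => G.cost s (u s)) N i /
    expectedSum (transMatrix u) (fun s => (u s).2.1) N i) atTop

/-- The long-run average cost of the transformed discrete-time problem from `i`. -/
def avgCostDT (G : MTDGame S L Att) (γ : ℝ) (u : MTDPolicy S T) (i : S) : ℝ :=
  limsup (fun N : ℕ =>
    1 / (N : ℝ) * expectedSum (transMatrixDT γ u) (fun s => G.costRate s (u s)) N i) atTop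

/-- `u` is an optimal stationary policy of the semi-Markov problem, for every initial state. -/
def IsOptimal (G : MTDGame S L Att) (u : MTDPolicy S T) : Prop :=
  ∀ i, ∀ v : MTDPolicy S T, G.avgCost u i ≤ G.avgCost v i

/-- `u` is an optimal stationary policy of the discrete-time problem, for every initial state. -/
def IsOptimalDT (G : MTDGame S L Att) (γ : ℝ) (u : MTDPolicy S T) : Prop :=
  ∀ i, ∀ v : MTDPolicy S T, G.avgCostDT γ u i ≤ G.avgCostDT γ v i

/-- The optimal cost vector of the discrete-time problem. -/
def optCostDT (G : MTDGame S L Att) (T : Set ℝ) (γ : ℝ) (i : S) : ℝ :=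
  ⨅ v : MTDPolicy S T, G.avgCostDT γ v i

/-- `u` is `ε`-optimal: the Cesàro limit `P*` of its discrete-time transition matrix exists and
`P* c ≤ λ + ε`, where `c` is its cost vector and `λ` the optimal cost vector. -/
def IsEpsOptimalDT (G : MTDGame S L Att) (γ ε : ℝ) (u : MTDPolicy S T) : Prop :=
  ∃ Q : Matrix S S ℝ, IsCesaroLimit (transMatrixDT γ u) Q ∧
    ∀ i, Q.mulVec (fun s => G.costRate s (u s)) i ≤ G.optCostDT T γ i + ε

/-- The one-stage value at state `i` of the action `x` with terminal values `V`. -/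
def stageValue (G : MTDGame S L Att) (γ : ℝ) (V : S → ℝ) (i : S) (x : MTDAction S T) : ℝ :=
  G.costRate i x + ∑ j, transProb γ i x j * V j

/-- The operator `F`, the minimization being applied to each state separately. -/
def bellman (G : MTDGame S L Att) (T : Set ℝ) (γ : ℝ) (V : S → ℝ) : S → ℝ :=
  fun i => ⨅ x : MTDAction S T, G.stageValue γ V i x

/-- `u` attains the minimum in the definition of `F(V)`. -/
def IsGreedy (G : MTDGame S L Att) (γ : ℝ) (V : S → ℝ) (u : MTDPolicy S T) : Prop :=
  ∀ i, ∀ x : MTDAction S T, G.stageValue γ V i (u i) ≤ G.stageValue γ V i x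

/-- The value iteration `V^{t+1} = F(κ_t V^t)` started at `V0`. -/
def valueIter (G : MTDGame S L Att) (T : Set ℝ) (γ : ℝ) (V0 : S → ℝ) : ℕ → S → ℝ
  | 0 => V0
  | t + 1 => G.bellman T γ (viKappa t • valueIter G T γ V0 t)

end MTDGame

end

/-! The transformed kernel follows `p` with weight `γ/τ` and otherwise stays put, so `τ (c/τ + P̃h -
h) = c + γ(Ph - h)`. Hence a solution `(g, h)` of the discrete-time optimality equation `F(h) = g +
h` yields one of the semi-Markov equation with `γ • h`. Telescoping `P h - h` along a trajectory
then shows that no policy beats `g` and that a greedy policy attains it, in both problems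
(`IsGreedy.isOptimal`).

No unichain hypothesis is needed, because every transition vector is available: jumping from any
state toward a minimizer of `V` gives `span F(V) ≤ 2B + (1 - γ/τ) span V`
(`spanSeminorm_bellman_le`), so the iterates have bounded span. Since `F` is nonexpansive in span
and `κ_t` varies slowly, successive differences tend to zero in span
(`tendsto_spanSeminorm_valueIter_succ_sub`), and so do `F(V^t) - V^t` and its discounted version. A
limit point of the normalized iterates solves the optimality equation (`exists_bellman_eq_add`).

For any `V`, `min (F(V) - V)` is a lower bound for all costs and `max (F(V) - V)` an upper bound for
the greedy cost, so a small span certifies near-optimality (`IsGreedy.isEpsOptimalDT`). -/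

/-! ### The span seminorm. -/

section SpanSeminorm

variable {S : Type*} [Fintype S]

theorem sub_le_spanSeminorm (x : S → ℝ) (i j : S) : x i - x j ≤ spanSeminorm x :=
  sub_le_sub (le_ciSup (Set.finite_range x).bddAbove i) (ciInf_le (Set.finite_range x).bddBelow j)

variable [Nonempty S]

theorem exists_spanSeminorm_eq (x : S → ℝ) :
    ∃ i j, spanSeminorm x = x i - x j ∧ ∀ k, x j ≤ x k ∧ x k ≤ x i := by
  obtain ⟨i, hi⟩ := Finite.exists_max x
  obtain ⟨j, hj⟩ := Finite.exists_min x
  refine ⟨i, j, le_antisymm ?_ (sub_le_spanSeminorm x i j), fun k => ⟨hj k, hi k⟩⟩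
  exact sub_le_sub (ciSup_le hi) (le_ciInf hj)

theorem spanSeminorm_le {x : S → ℝ} {r : ℝ} (h : ∀ i j, x i - x j ≤ r) : spanSeminorm x ≤ r := by
  obtain ⟨i, j, hij, -⟩ := exists_spanSeminorm_eq x
  exact hij ▸ h i j

theorem spanSeminorm_nonneg (x : S → ℝ) : 0 ≤ spanSeminorm x := by
  have i := Classical.arbitrary S
  simpa using sub_le_spanSeminorm x i i

theorem spanSeminorm_add_le (x y : S → ℝ) :
    spanSeminorm (x + y) ≤ spanSeminorm x + spanSeminorm y :=
  spanSeminorm_le fun i j => by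
    have := sub_le_spanSeminorm x i j
    have := sub_le_spanSeminorm y i j
    simp only [Pi.add_apply]
    linarith

theorem spanSeminorm_smul_le {a : ℝ} (ha : 0 ≤ a) (x : S → ℝ) :
    spanSeminorm (a • x) ≤ a * spanSeminorm x :=
  spanSeminorm_le fun i j => by
    have := mul_le_mul_of_nonneg_left (sub_le_spanSeminorm x i j) ha
    simp only [Pi.smul_apply, smul_eq_mul]
    linarith

theorem spanSeminorm_le_two_mul_norm (x : S → ℝ) : spanSeminorm x ≤ 2 * ‖x‖ :=
  spanSeminorm_le fun i j => by
    have hi := abs_le.1 (norm_le_pi_norm x i)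
    have hj := abs_le.1 (norm_le_pi_norm x j)
    linarith [hi.2, hj.1]

end SpanSeminorm

/-! ### Poisson inequalities and long-run ratios for stochastic matrices. -/

section StochasticMatrix

open Matrix

variable {S : Type*} [Fintype S] [DecidableEq S] {P : Matrix S S ℝ}

theorem mulVec_le_of_mem_rowStochastic (hP : P ∈ rowStochastic ℝ S) {x : S → ℝ} {r : ℝ}
    (h : ∀ j, x j ≤ r) (i : S) : (P *ᵥ x) i ≤ r := by
  rw [mem_rowStochastic_iff_sum] at hP
  calc (P *ᵥ x) i = ∑ j, P i j * x j := rfl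
    _ ≤ ∑ j, P i j * r := Finset.sum_le_sum fun j _ => mul_le_mul_of_nonneg_left (h j) (hP.1 i j)
    _ = r := by rw [← Finset.sum_mul, hP.2, one_mul]

theorem le_mulVec_of_mem_rowStochastic (hP : P ∈ rowStochastic ℝ S) {x : S → ℝ} {r : ℝ}
    (h : ∀ j, r ≤ x j) (i : S) : r ≤ (P *ᵥ x) i := by
  have := mulVec_le_of_mem_rowStochastic hP (x := -x) (r := -r) (fun j => neg_le_neg (h j)) i
  rw [mulVec_neg] at this
  exact neg_le_neg_iff.1 this

theorem expectedSum_mono (hP : P ∈ rowStochastic ℝ S) {f g : S → ℝ} (h : ∀ i, f i ≤ g i)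
    (N : ℕ) (i : S) : expectedSum P f N i ≤ expectedSum P g N i := by
  refine Finset.sum_le_sum fun k _ => ?_
  have := le_mulVec_of_mem_rowStochastic (pow_mem hP k) (x := g - f) (r := 0)
    (fun j => sub_nonneg.2 (h j)) i
  rw [mulVec_sub] at this
  exact sub_nonneg.1 this

theorem expectedSum_add (f g : S → ℝ) (N : ℕ) (i : S) :
    expectedSum P (f + g) N i = expectedSum P f N i + expectedSum P g N i := by
  simp [expectedSum, mulVec_add, Finset.sum_add_distrib]

theorem expectedSum_smul (a : ℝ) (f : S → ℝ) (N : ℕ) (i : S) :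
    expectedSum P (a • f) N i = a * expectedSum P f N i := by
  simp [expectedSum, mulVec_smul, Finset.mul_sum]

theorem expectedSum_one (hP : P ∈ rowStochastic ℝ S) (N : ℕ) (i : S) :
    expectedSum P 1 N i = N := by
  simp [expectedSum, fun k => one_vecMul_of_mem_rowStochastic (pow_mem hP k)]

theorem expectedSum_mulVec_sub (h : S → ℝ) (N : ℕ) (i : S) :
    expectedSum P (P *ᵥ h - h) N i = (P ^ N *ᵥ h) i - h i := by
  have := Finset.sum_range_sub (fun k => (P ^ k *ᵥ h) i) N
  simp only [pow_zero, one_mulVec] at this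
  simp only [expectedSum, mulVec_sub, mulVec_mulVec, ← pow_succ, Pi.sub_apply]
  exact this

/-- The sum telescopes, and `P ^ N *ᵥ h` stays between the minimum and the maximum of `h`, so the
bound does not grow with `N`. -/
theorem abs_expectedSum_mulVec_sub_le [Nonempty S] (hP : P ∈ rowStochastic ℝ S) (h : S → ℝ)
    (N : ℕ) (i : S) : |expectedSum P (P *ᵥ h - h) N i| ≤ spanSeminorm h := by
  obtain ⟨a, b, hab, hk⟩ := exists_spanSeminorm_eq h
  have h1 := mulVec_le_of_mem_rowStochastic (pow_mem hP N) (fun j => (hk j).2) i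
  have h2 := le_mulVec_of_mem_rowStochastic (pow_mem hP N) (fun j => (hk j).1) i
  rw [expectedSum_mulVec_sub, abs_le]
  constructor <;> linarith [(hk i).1, (hk i).2]

/-- A Poisson inequality bounds the expected total cost from below. -/
theorem mul_expectedSum_sub_le [Nonempty S] (hP : P ∈ rowStochastic ℝ S) {f d h : S → ℝ} {g : ℝ}
    (hf : ∀ i, g * d i ≤ f i + ((P *ᵥ h) i - h i)) (N : ℕ) (i : S) :
    g * expectedSum P d N i - spanSeminorm h ≤ expectedSum P f N i := by
  have h1 := expectedSum_mono hP (f := g • d) (g := f + (P *ᵥ h - h)) hf N i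
  rw [expectedSum_add, expectedSum_smul] at h1
  have h2 := (abs_le.1 (abs_expectedSum_mulVec_sub_le hP h N i)).2
  linarith

/-- A Poisson inequality bounds the expected total cost from above. -/
theorem expectedSum_le_mul_add [Nonempty S] (hP : P ∈ rowStochastic ℝ S) {f d h : S → ℝ} {g : ℝ}
    (hf : ∀ i, f i + ((P *ᵥ h) i - h i) ≤ g * d i) (N : ℕ) (i : S) :
    expectedSum P f N i ≤ g * expectedSum P d N i + spanSeminorm h := by
  have h1 := expectedSum_mono hP (f := f + (P *ᵥ h - h)) (g := g • d) hf N i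
  rw [expectedSum_add, expectedSum_smul] at h1
  have h2 := (abs_le.1 (abs_expectedSum_mulVec_sub_le hP h N i)).1
  linarith

theorem mul_le_expectedSum (hP : P ∈ rowStochastic ℝ S) {d : S → ℝ} {a : ℝ}
    (hd : ∀ i, a ≤ d i) (N : ℕ) (i : S) : a * N ≤ expectedSum P d N i := by
  rw [← expectedSum_one hP N i, ← expectedSum_smul]
  exact expectedSum_mono hP (fun j => by simpa using hd j) N i

theorem tendsto_const_sub_div_natCast (g C : ℝ) :
    Tendsto (fun N : ℕ => g - C / N) atTop (𝓝 g) := by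
  simpa using tendsto_const_nhds.sub (tendsto_const_div_atTop_nhds_zero_nat C)

theorem eventually_sub_div_le_ratio [Nonempty S] (hP : P ∈ rowStochastic ℝ S) {f d h : S → ℝ}
    {g a : ℝ} (ha : 0 < a) (hd : ∀ i, a ≤ d i)
    (hf : ∀ i, g * d i ≤ f i + ((P *ᵥ h) i - h i)) (i : S) :
    ∀ᶠ N : ℕ in atTop, g - spanSeminorm h / a / N ≤ expectedSum P f N i / expectedSum P d N i := by
  filter_upwards [eventually_gt_atTop 0] with N hN
  have hN' : (0 : ℝ) < N := Nat.cast_pos.2 hN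
  have h1 := mul_le_expectedSum hP hd N i
  have h2 : 0 < expectedSum P d N i := lt_of_lt_of_le (by positivity) h1
  have h3 := mul_expectedSum_sub_le hP hf N i
  -- The bounded telescoping error is divided by a denominator of at least `a * N`.
  have h4 : spanSeminorm h ≤ spanSeminorm h / a / N * expectedSum P d N i := by
    calc spanSeminorm h = spanSeminorm h / a / N * (a * N) := by field_simp
      _ ≤ _ := mul_le_mul_of_nonneg_left h1 (by have := spanSeminorm_nonneg h; positivity)
  rw [le_div_iff₀ h2, sub_mul]
  linarith

/-- Real `liminf` and `limsup` take default values on unbounded sequences; this bound rules that out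
in the two lower estimates below. -/
theorem isBoundedUnder_ratio (hP : P ∈ rowStochastic ℝ S) {f d : S → ℝ} {a B : ℝ} (ha : 0 < a)
    (hd : ∀ i, a ≤ d i) (hfB : ∀ i, f i ≤ B * d i) (i : S) :
    IsBoundedUnder (· ≤ ·) atTop
      fun N : ℕ => expectedSum P f N i / expectedSum P d N i := by
  refine isBoundedUnder_of_eventually_le (a := B) ?_
  filter_upwards [eventually_gt_atTop 0] with N hN
  have h1 := mul_le_expectedSum hP hd N i
  have h2 : 0 < expectedSum P d N i :=
    lt_of_lt_of_le (mul_pos ha (Nat.cast_pos.2 hN)) h1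
  rw [div_le_iff₀ h2, ← expectedSum_smul]
  exact expectedSum_mono hP hfB N i

variable [Nonempty S] {f d h : S → ℝ} {g a B : ℝ}

theorem le_liminf_ratio (hP : P ∈ rowStochastic ℝ S) (ha : 0 < a)
    (hd : ∀ i, a ≤ d i) (hfB : ∀ i, f i ≤ B * d i)
    (hf : ∀ i, g * d i ≤ f i + ((P *ᵥ h) i - h i)) (i : S) :
    g ≤ liminf (fun N : ℕ => expectedSum P f N i / expectedSum P d N i) atTop := by
  have ht := tendsto_const_sub_div_natCast g (spanSeminorm h / a)
  rw [← ht.liminf_eq]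
  exact liminf_le_liminf (eventually_sub_div_le_ratio hP ha hd hf i) ht.isBoundedUnder_ge
    (isBoundedUnder_ratio hP ha hd hfB i).isCoboundedUnder_ge

theorem le_limsup_ratio (hP : P ∈ rowStochastic ℝ S) (ha : 0 < a)
    (hd : ∀ i, a ≤ d i) (hfB : ∀ i, f i ≤ B * d i)
    (hf : ∀ i, g * d i ≤ f i + ((P *ᵥ h) i - h i)) (i : S) :
    g ≤ limsup (fun N : ℕ => expectedSum P f N i / expectedSum P d N i) atTop := by
  have ht := tendsto_const_sub_div_natCast g (spanSeminorm h / a)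
  rw [← ht.limsup_eq]
  exact limsup_le_limsup (eventually_sub_div_le_ratio hP ha hd hf i)
    ht.isCoboundedUnder_le (isBoundedUnder_ratio hP ha hd hfB i)

theorem tendsto_ratio (hP : P ∈ rowStochastic ℝ S) (ha : 0 < a) (hd : ∀ i, a ≤ d i)
    (hf : ∀ i, f i + ((P *ᵥ h) i - h i) = g * d i) (i : S) :
    Tendsto (fun N : ℕ => expectedSum P f N i / expectedSum P d N i) atTop (𝓝 g) := by
  have h1 := eventually_sub_div_le_ratio hP ha hd (fun j => (hf j).ge) i
  -- Negating `f`, `h` and `g` turns the lower estimate into the upper one.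
  have h2 := eventually_sub_div_le_ratio hP (f := -f) (h := -h) (g := -g) ha hd
    (fun j => by have := hf j; simp only [mulVec_neg, Pi.neg_apply]; linarith) i
  refine tendsto_of_tendsto_of_tendsto_of_le_of_le'
    (tendsto_const_sub_div_natCast g (spanSeminorm h / a))
    (by simpa using (tendsto_const_sub_div_natCast (-g) (spanSeminorm (-h) / a)).neg) h1 ?_
  filter_upwards [h2] with N hN
  have : expectedSum P (-f) N i = -expectedSum P f N i := by
    rw [← neg_one_smul ℝ f, expectedSum_smul, neg_one_mul]
  rw [this, neg_div] at hN
  linarith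

end StochasticMatrix

/-! ### Cesàro limits of powers of a stochastic matrix. -/

section CesaroLimit

open Matrix

variable {S : Type*} [Fintype S] [DecidableEq S] {P : Matrix S S ℝ}

/-- The average of the first `N` powers of a matrix. -/
noncomputable def cesaroMean (P : Matrix S S ℝ) (N : ℕ) : Matrix S S ℝ :=
  (N : ℝ)⁻¹ • ∑ k ∈ Finset.range N, P ^ k

theorem cesaroMean_mulVec (f : S → ℝ) (N : ℕ) (i : S) :
    (cesaroMean P N *ᵥ f) i = (N : ℝ)⁻¹ * expectedSum P f N i := by
  simp [cesaroMean, smul_mulVec, sum_mulVec, expectedSum]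

theorem cesaroMean_mem_Icc (hP : P ∈ rowStochastic ℝ S) (N : ℕ) (i j : S) :
    cesaroMean P N i j ∈ Set.Icc (0 : ℝ) 1 := by
  have h0 : ∀ k, 0 ≤ (P ^ k) i j := fun k => nonneg_of_mem_rowStochastic (pow_mem hP k)
  have h1 : ∀ k, (P ^ k) i j ≤ 1 := fun k => le_one_of_mem_rowStochastic (pow_mem hP k)
  simp only [cesaroMean, Matrix.smul_apply, Matrix.sum_apply, smul_eq_mul]
  refine ⟨mul_nonneg (by positivity) (Finset.sum_nonneg fun k _ => h0 k), ?_⟩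
  calc (N : ℝ)⁻¹ * ∑ k ∈ Finset.range N, (P ^ k) i j
      ≤ (N : ℝ)⁻¹ * ∑ k ∈ Finset.range N, 1 := by gcongr with k; exact h1 k
    _ ≤ 1 := by simpa using inv_mul_le_one

theorem tendsto_inv_smul_pow_sub_one (hP : P ∈ rowStochastic ℝ S) :
    Tendsto (fun N : ℕ => (N : ℝ)⁻¹ • (P ^ N - 1)) atTop (𝓝 0) := by
  refine tendsto_pi_nhds.2 fun i => tendsto_pi_nhds.2 fun j => ?_
  refine squeeze_zero_norm (fun N => ?_) (tendsto_inv_atTop_nhds_zero_nat (𝕜 := ℝ))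
  have hQ : ∀ Q ∈ rowStochastic ℝ S, Q i j ∈ Set.Icc (0 : ℝ) 1 := fun Q hQ =>
    ⟨nonneg_of_mem_rowStochastic hQ, le_one_of_mem_rowStochastic hQ⟩
  obtain ⟨h1, h2⟩ := hQ _ (pow_mem hP N)
  obtain ⟨h3, h4⟩ := hQ _ (one_mem _)
  have h5 : |(P ^ N) i j - (1 : Matrix S S ℝ) i j| ≤ 1 := abs_le.2 ⟨by linarith, by linarith⟩
  have h6 : (0 : ℝ) ≤ (N : ℝ)⁻¹ := by positivity
  simpa [abs_mul, abs_of_nonneg h6] using mul_le_mul_of_nonneg_left h5 h6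

/-- Multiplying the mean by `P` on either side changes it by `N⁻¹ • (P ^ N - 1)`, which vanishes in
the limit. -/
theorem mul_eq_of_mapClusterPt_cesaroMean (hP : P ∈ rowStochastic ℝ S) {Q : Matrix S S ℝ}
    (hQ : MapClusterPt Q atTop (cesaroMean P)) : P * Q = Q ∧ Q * P = Q := by
  obtain ⟨U, hU, hUQ⟩ := mapClusterPt_iff_ultrafilter.1 hQ
  have hz := (tendsto_inv_smul_pow_sub_one hP).mono_left hU
  constructor
  · refine tendsto_nhds_unique (tendsto_const_nhds.mul hUQ) ?_
    have := hUQ.add hz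
    rw [add_zero] at this
    refine this.congr fun N => ?_
    have h := mul_geom_sum P N
    simp only [cesaroMean, Matrix.mul_smul]
    rw [← smul_add, ← h]
    congr 1
    noncomm_ring
  · refine tendsto_nhds_unique (hUQ.mul tendsto_const_nhds) ?_
    have := hUQ.add hz
    rw [add_zero] at this
    refine this.congr fun N => ?_
    have h := geom_sum_mul P N
    simp only [cesaroMean, Matrix.smul_mul]
    rw [← smul_add, ← h]
    congr 1
    noncomm_ring

theorem cesaroMean_mul_of_mul_eq {Q : Matrix S S ℝ} (hQ : P * Q = Q) {N : ℕ} (hN : N ≠ 0) :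
    cesaroMean P N * Q = Q := by
  have h : ∀ k, P ^ k * Q = Q := fun k => by
    induction k with
    | zero => simp
    | succ k ih => rw [pow_succ, mul_assoc, hQ, ih]
  have hN' : (N : ℝ) ≠ 0 := Nat.cast_ne_zero.2 hN
  simp only [cesaroMean, Matrix.smul_mul, Finset.sum_mul, h, Finset.sum_const, Finset.card_range]
  rw [← Nat.cast_smul_eq_nsmul ℝ, smul_smul, inv_mul_cancel₀ hN', one_smul]

theorem mul_cesaroMean_of_mul_eq {Q : Matrix S S ℝ} (hQ : Q * P = Q) {N : ℕ} (hN : N ≠ 0) :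
    Q * cesaroMean P N = Q := by
  have h : ∀ k, Q * P ^ k = Q := fun k => by
    induction k with
    | zero => simp
    | succ k ih => rw [pow_succ', ← mul_assoc, hQ, ih]
  have hN' : (N : ℝ) ≠ 0 := Nat.cast_ne_zero.2 hN
  simp only [cesaroMean, Matrix.mul_smul, Finset.mul_sum, h, Finset.sum_const, Finset.card_range]
  rw [← Nat.cast_smul_eq_nsmul ℝ, smul_smul, inv_mul_cancel₀ hN', one_smul]

/-- The powers of a finite stochastic matrix converge in the Cesàro sense. -/
theorem exists_isCesaroLimit (hP : P ∈ rowStochastic ℝ S) : ∃ Q, IsCesaroLimit P Q := by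
  obtain ⟨K, hK, hmem⟩ : ∃ K : Set (Matrix S S ℝ), IsCompact K ∧ ∀ N, cesaroMean P N ∈ K :=
    ⟨Set.univ.pi fun _ => Set.univ.pi fun _ => Set.Icc (0 : ℝ) 1,
      isCompact_univ_pi fun _ => isCompact_univ_pi fun _ => isCompact_Icc,
      fun N i _ j _ => cesaroMean_mem_Icc hP N i j⟩
  obtain ⟨Q, -, hQ⟩ := hK.exists_mapClusterPt (f := atTop) (u := cesaroMean P)
    (tendsto_principal.2 (Eventually.of_forall hmem))
  -- By compactness it suffices that cluster points coincide. For two of them, each is fixed by `P`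
  -- on both sides, hence by the means with `N ≠ 0`; passing to the limit in one factor at a time
  -- gives `Q * Q' = Q'` and `Q * Q' = Q`.
  refine ⟨Q, hK.tendsto_nhds_of_unique_mapClusterPt (f := cesaroMean P)
    (Eventually.of_forall hmem) fun Q' _ hQ' => ?_⟩
  obtain ⟨U, hU, hUQ⟩ := mapClusterPt_iff_ultrafilter.1 hQ
  obtain ⟨U', hU', hUQ'⟩ := mapClusterPt_iff_ultrafilter.1 hQ'
  have h1 : Q * Q' = Q' := by
    refine tendsto_nhds_unique (hUQ.mul tendsto_const_nhds) (tendsto_const_nhds.congr' ?_)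
    filter_upwards [hU (eventually_ne_atTop 0)] with N hN
    exact (cesaroMean_mul_of_mul_eq (mul_eq_of_mapClusterPt_cesaroMean hP hQ').1 hN).symm
  have h2 : Q * Q' = Q := by
    refine tendsto_nhds_unique (tendsto_const_nhds.mul hUQ') (tendsto_const_nhds.congr' ?_)
    filter_upwards [hU' (eventually_ne_atTop 0)] with N hN
    exact (mul_cesaroMean_of_mul_eq (mul_eq_of_mapClusterPt_cesaroMean hP hQ).2 hN).symm
  rw [← h1, h2]

theorem IsCesaroLimit.mulVec_le [Nonempty S] {Q : Matrix S S ℝ} (hQ : IsCesaroLimit P Q)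
    (hP : P ∈ rowStochastic ℝ S) {f h : S → ℝ} {g : ℝ}
    (hf : ∀ i, f i + ((P *ᵥ h) i - h i) ≤ g) (i : S) : (Q *ᵥ f) i ≤ g := by
  have h1 : Tendsto (fun N => (cesaroMean P N *ᵥ f) i) atTop (𝓝 ((Q *ᵥ f) i)) :=
    ((continuous_apply i).comp
      (continuous_id.matrix_mulVec continuous_const)).continuousAt.tendsto.comp hQ
  have h2 : Tendsto (fun N : ℕ => g + spanSeminorm h / N) atTop (𝓝 g) := by
    simpa using tendsto_const_nhds.add (tendsto_const_div_atTop_nhds_zero_nat (spanSeminorm h))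
  refine le_of_tendsto_of_tendsto h1 h2 ?_
  filter_upwards [eventually_gt_atTop 0] with N hN
  have hN' : (0 : ℝ) < N := Nat.cast_pos.2 hN
  have h3 := expectedSum_le_mul_add hP (d := 1) (g := g) (h := h) (f := f)
    (fun j => by simpa using hf j) N i
  rw [expectedSum_one hP] at h3
  rw [cesaroMean_mulVec, inv_mul_le_iff₀ hN']
  calc _ ≤ _ := h3
    _ = _ := by field_simp

end CesaroLimit

/-! ### The Bellman operator and optimality of greedy policies. -/

namespace MTDGame

open Matrix

variable {S L Att : Type*} [Fintype S] [DecidableEq S] [Fintype L] {T : Set ℝ} {γ : ℝ}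

/-- The row is the convex combination of `p` and the unit mass at `i` with weight `γ / τ`, which is
at most one. -/
theorem transProb_nonneg (hγ : 0 < γ) (hT : ∀ τ ∈ T, γ ≤ τ) (i : S) (x : MTDAction S T) (j : S) :
    0 ≤ transProb γ i x j := by
  have hτ : 0 < x.2.1 := hγ.trans_le (hT _ x.2.2)
  have h1 : γ / x.2.1 ≤ 1 := (div_le_one hτ).2 (hT _ x.2.2)
  have h2 : 0 ≤ γ / x.2.1 * x.1.1 j := mul_nonneg (by positivity) (x.1.2.1 j)
  have h3 : 0 ≤ (1 - γ / x.2.1) * (1 : Matrix S S ℝ) i j :=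
    mul_nonneg (sub_nonneg.2 h1) (nonneg_of_mem_rowStochastic (one_mem _))
  have h4 : transProb γ i x j
      = γ / x.2.1 * x.1.1 j + (1 - γ / x.2.1) * (1 : Matrix S S ℝ) i j := by
    rw [transProb]; ring
  linarith

theorem sum_transProb_mul (i : S) (x : MTDAction S T) (V : S → ℝ) :
    ∑ j, transProb γ i x j * V j = V i + γ / x.2.1 * (∑ j, x.1.1 j * V j - V i) := by
  have h : ∑ j, (1 : Matrix S S ℝ) i j * V j = V i := by simp [Matrix.one_apply]
  calc ∑ j, transProb γ i x j * V j
      = ∑ j, (γ / x.2.1 * (x.1.1 j * V j) + (1 - γ / x.2.1) * ((1 : Matrix S S ℝ) i j * V j)) :=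
        Finset.sum_congr rfl fun j _ => by rw [transProb]; ring
    _ = _ := by rw [Finset.sum_add_distrib, ← Finset.mul_sum, ← Finset.mul_sum, h]; ring

theorem sum_transProb (i : S) (x : MTDAction S T) : ∑ j, transProb γ i x j = 1 := by
  have h : ∑ j, x.1.1 j = 1 := x.1.2.2
  simpa [h] using sum_transProb_mul (γ := γ) i x 1

theorem transMatrixDT_mem (hγ : 0 < γ) (hT : ∀ τ ∈ T, γ ≤ τ) (u : MTDPolicy S T) :
    transMatrixDT γ u ∈ rowStochastic ℝ S :=
  mem_rowStochastic_iff_sum.2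
    ⟨fun i j => transProb_nonneg hγ hT i (u i) j, fun i => sum_transProb i (u i)⟩

theorem transMatrix_mem (u : MTDPolicy S T) : transMatrix u ∈ rowStochastic ℝ S :=
  mem_rowStochastic_iff_sum.2 ⟨fun i j => (u i).1.2.1 j, fun i => (u i).1.2.2⟩

variable (G : MTDGame S L Att)

theorem stageValue_eq_transMatrixDT (V : S → ℝ) (u : MTDPolicy S T) (i : S) :
    G.stageValue γ V i (u i) = G.costRate i (u i) + (transMatrixDT γ u *ᵥ V) i := rfl

theorem continuous_stageValue (hγ : 0 < γ) (hT : ∀ τ ∈ T, γ ≤ τ)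
    (hcont : ∀ i : S, Continuous fun x : MTDAction S T => G.costRate i x) (V : S → ℝ) (i : S) :
    Continuous fun x : MTDAction S T => G.stageValue γ V i x := by
  have hτ : ∀ x : MTDAction S T, (x.2.1 : ℝ) ≠ 0 := fun x => (hγ.trans_le (hT _ x.2.2)).ne'
  have hp : ∀ j, Continuous fun x : MTDAction S T => x.1.1 j := fun j =>
    (continuous_apply j).comp (continuous_subtype_val.comp continuous_fst)
  have h2 : Continuous fun x : MTDAction S T => (x.2.1 : ℝ) :=
    continuous_subtype_val.comp continuous_snd
  refine (hcont i).add (continuous_finsetSum _ fun j _ => ?_)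
  refine Continuous.mul ?_ continuous_const
  exact (continuous_const.mul (((hp j).sub continuous_const).div h2 hτ)).add continuous_const

theorem exists_isGreedy [Nonempty S] (hγ : 0 < γ) (hT : ∀ τ ∈ T, γ ≤ τ) (hTcpt : IsCompact T)
    (hTne : T.Nonempty)
    (hcont : ∀ i : S, Continuous fun x : MTDAction S T => G.costRate i x) (V : S → ℝ) :
    ∃ u : MTDPolicy S T, G.IsGreedy γ V u := by
  have := isCompact_iff_compactSpace.1 hTcpt
  have := hTne.to_subtype
  have h : ∀ i : S, ∃ x : MTDAction S T, ∀ y : MTDAction S T,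
      G.stageValue γ V i x ≤ G.stageValue γ V i y := by
    intro i
    obtain ⟨x, -, hx⟩ := isCompact_univ.exists_isMinOn Set.univ_nonempty
      (G.continuous_stageValue hγ hT hcont V i).continuousOn
    exact ⟨x, fun y => hx (Set.mem_univ y)⟩
  choose u hu using h
  exact ⟨u, hu⟩

variable {G}

/-- A real infimum is meaningful only for a nonempty family bounded below; the greedy action
supplies both. -/
theorem IsGreedy.bellman_eq {V : S → ℝ} {u : MTDPolicy S T} (hu : G.IsGreedy γ V u) (i : S) :
    G.bellman T γ V i = G.stageValue γ V i (u i) :=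
  le_antisymm (ciInf_le ⟨_, Set.forall_mem_range.2 (hu i)⟩ (u i))
    (have : Nonempty (MTDAction S T) := ⟨u i⟩; le_ciInf (hu i))

theorem IsGreedy.bellman_le {V : S → ℝ} {u : MTDPolicy S T} (hu : G.IsGreedy γ V u) (i : S)
    (x : MTDAction S T) : G.bellman T γ V i ≤ G.stageValue γ V i x :=
  hu.bellman_eq i ▸ hu i x

variable (G) in
theorem stageValue_sub_le (hγ : 0 < γ) (hT : ∀ τ ∈ T, γ ≤ τ) {V W : S → ℝ} {r : ℝ}
    (h : ∀ j, V j - W j ≤ r) (i : S) (x : MTDAction S T) :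
    G.stageValue γ V i x - G.stageValue γ W i x ≤ r := by
  -- The constant policy `x` makes the single row a row of a stochastic matrix.
  have h1 := mulVec_le_of_mem_rowStochastic (transMatrixDT_mem hγ hT fun _ => x) (x := V - W) h i
  rw [mulVec_sub, Pi.sub_apply] at h1
  have h2 := G.stageValue_eq_transMatrixDT (γ := γ) V (fun _ => x) i
  have h3 := G.stageValue_eq_transMatrixDT (γ := γ) W (fun _ => x) i
  linarith

theorem bellman_sub_le (hγ : 0 < γ) (hT : ∀ τ ∈ T, γ ≤ τ)
    (hgr : ∀ V : S → ℝ, ∃ u : MTDPolicy S T, G.IsGreedy γ V u) {V W : S → ℝ} {r : ℝ}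
    (h : ∀ j, V j - W j ≤ r) (i : S) : G.bellman T γ V i - G.bellman T γ W i ≤ r := by
  obtain ⟨u, hu⟩ := hgr V
  obtain ⟨w, hw⟩ := hgr W
  rw [hw.bellman_eq i]
  linarith [hu.bellman_le i (w i), G.stageValue_sub_le hγ hT h i (w i)]

theorem spanSeminorm_bellman_sub_le [Nonempty S] (hγ : 0 < γ) (hT : ∀ τ ∈ T, γ ≤ τ)
    (hgr : ∀ V : S → ℝ, ∃ u : MTDPolicy S T, G.IsGreedy γ V u) (V W : S → ℝ) :
    spanSeminorm (G.bellman T γ V - G.bellman T γ W) ≤ spanSeminorm (V - W) := by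
  obtain ⟨a, b, hab, hk⟩ := exists_spanSeminorm_eq (V - W)
  refine spanSeminorm_le fun i j => ?_
  have h1 := bellman_sub_le hγ hT hgr (fun k => (hk k).2) i
  have h2 := bellman_sub_le hγ hT hgr (V := W) (W := V) (r := -((V - W) b))
    (fun k => by have := (hk k).1; simp only [Pi.sub_apply] at this ⊢; linarith) j
  simp only [Pi.sub_apply] at *
  linarith

/-- Moving directly to a state of minimal value bounds the span of the updated value. -/
theorem spanSeminorm_bellman_le [Nonempty S] (hγ : 0 < γ) (hT : ∀ τ ∈ T, γ ≤ τ) {τ : ℝ}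
    (hτ : τ ∈ T) (hgr : ∀ V : S → ℝ, ∃ u : MTDPolicy S T, G.IsGreedy γ V u) {B : ℝ}
    (hB : ∀ i, ∀ x : MTDAction S T, |G.costRate i x| ≤ B) (V : S → ℝ) :
    spanSeminorm (G.bellman T γ V) ≤ 2 * B + (1 - γ / τ) * spanSeminorm V := by
  obtain ⟨a, b, hab, hk⟩ := exists_spanSeminorm_eq V
  obtain ⟨u, hu⟩ := hgr V
  have hτ0 : 0 < τ := hγ.trans_le (hT _ hτ)
  have h1 : γ / τ ≤ 1 := (div_le_one hτ0).2 (hT _ hτ)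
  refine spanSeminorm_le fun i j => ?_
  -- The trial action heads for the minimizer `b`: `F(V) i ≤ B + (1 - γ/τ) V i + (γ/τ) V b`, while
  -- below `F(V) j ≥ -B + V b`.
  have h2 := hu.bellman_le i (⟨Pi.single b 1, single_mem_stdSimplex ℝ b⟩, ⟨τ, hτ⟩)
  rw [stageValue, sum_transProb_mul] at h2
  simp only [Pi.single_apply, ite_mul, one_mul, zero_mul, Finset.sum_ite_eq', Finset.mem_univ,
    if_true] at h2
  have h3 := (abs_le.1 (hB i (⟨Pi.single b 1, single_mem_stdSimplex ℝ b⟩, ⟨τ, hτ⟩))).2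
  have h4 := le_mulVec_of_mem_rowStochastic (transMatrixDT_mem hγ hT u) (fun k => (hk k).1) j
  have h5 := (abs_le.1 (hB j (u j))).1
  have h6 : G.bellman T γ V j = _ := (hu.bellman_eq j).trans (G.stageValue_eq_transMatrixDT V u j)
  have h7 : (1 - γ / τ) * V i ≤ (1 - γ / τ) * V a :=
    mul_le_mul_of_nonneg_left (hk i).2 (sub_nonneg.2 h1)
  rw [hab]
  linarith

/-- With unit durations the discrete-time average is a ratio, so the same ratio lemmas serve both
problems. -/
theorem avgCostDT_eq (hγ : 0 < γ) (hT : ∀ τ ∈ T, γ ≤ τ) (u : MTDPolicy S T) (i : S) :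
    G.avgCostDT γ u i = limsup (fun N : ℕ =>
      expectedSum (transMatrixDT γ u) (fun s => G.costRate s (u s)) N i /
        expectedSum (transMatrixDT γ u) 1 N i) atTop := by
  simp only [avgCostDT, expectedSum_one (transMatrixDT_mem hγ hT u), div_eq_inv_mul, mul_one]

/-- Every stationary policy costs at least the minimal increment of the value. -/
theorem le_avgCostDT [Nonempty S] (hγ : 0 < γ) (hT : ∀ τ ∈ T, γ ≤ τ) {B : ℝ}
    (hB : ∀ i, ∀ x : MTDAction S T, |G.costRate i x| ≤ B) {V : S → ℝ} {w : MTDPolicy S T}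
    (hw : G.IsGreedy γ V w) {r : ℝ} (hr : ∀ i, r ≤ G.bellman T γ V i - V i)
    (v : MTDPolicy S T) (i : S) : r ≤ G.avgCostDT γ v i := by
  rw [avgCostDT_eq hγ hT]
  refine le_limsup_ratio (B := B) (h := V) (transMatrixDT_mem hγ hT v) one_pos (fun _ => le_rfl)
    (fun j => by simpa using (abs_le.1 (hB j (v j))).2) (fun j => ?_) i
  have h1 := hw.bellman_le j (v j)
  rw [stageValue_eq_transMatrixDT] at h1
  have := hr j
  simp only [mul_one]
  linarith

/-- The minimum of `F(V) - V` lies below the optimal cost, and the maximum bounds `P* c` for the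
greedy policy; the span is the gap. As `V` is arbitrary, this covers both `V^t` and `κ_t V^t`. -/
theorem IsGreedy.isEpsOptimalDT [Nonempty S] (hγ : 0 < γ) (hT : ∀ τ ∈ T, γ ≤ τ) {B : ℝ}
    (hB : ∀ i, ∀ x : MTDAction S T, |G.costRate i x| ≤ B) {V : S → ℝ} {u : MTDPolicy S T}
    (hu : G.IsGreedy γ V u) {ε : ℝ} (hε : spanSeminorm (G.bellman T γ V - V) ≤ ε) :
    G.IsEpsOptimalDT γ ε u := by
  obtain ⟨Q, hQ⟩ := exists_isCesaroLimit (transMatrixDT_mem hγ hT u)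
  obtain ⟨a, b, hab, hk⟩ := exists_spanSeminorm_eq (G.bellman T γ V - V)
  refine ⟨Q, hQ, fun i => ?_⟩
  have h1 := hQ.mulVec_le (transMatrixDT_mem hγ hT u) (f := fun s => G.costRate s (u s)) (h := V)
    (g := (G.bellman T γ V - V) a) (fun j => by
      have h2 := hu.bellman_eq j
      rw [stageValue_eq_transMatrixDT] at h2
      have h3 := (hk j).2
      rw [Pi.sub_apply _ _ j] at h3
      linarith) i
  have : Nonempty (MTDPolicy S T) := ⟨u⟩
  have h4 : (G.bellman T γ V - V) b ≤ G.optCostDT T γ i :=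
    le_ciInf fun v => le_avgCostDT hγ hT hB hu (fun j => (hk j).1) v i
  linarith

/-- A policy that is greedy for a solution of the optimality equation is optimal for the
discrete-time and for the semi-Markov problem. -/
theorem IsGreedy.isOptimal [Nonempty S] (hγ : 0 < γ) (hT : ∀ τ ∈ T, γ ≤ τ) {B : ℝ}
    (hB : ∀ i, ∀ x : MTDAction S T, |G.costRate i x| ≤ B) {h : S → ℝ} {u : MTDPolicy S T}
    (hu : G.IsGreedy γ h u) {g : ℝ} (hg : ∀ i, G.bellman T γ h i = g + h i) :
    G.IsOptimalDT γ u ∧ G.IsOptimal u := by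
  have hτ : ∀ x : MTDAction S T, γ ≤ x.2.1 := fun x => hT _ x.2.2
  have hcost : ∀ i, ∀ x : MTDAction S T, G.cost i x = G.costRate i x * x.2.1 := fun i x =>
    (div_mul_cancel₀ _ (hγ.trans_le (hτ x)).ne').symm
  -- The data transformation: multiplying the discrete-time Poisson expression by `τ` gives the
  -- semi-Markov one, with `γ • h` in place of `h`.
  have hsm : ∀ (v : MTDPolicy S T) (i : S),
      G.cost i (v i) + ((transMatrix v *ᵥ (γ • h)) i - (γ • h) i)
        = (G.stageValue γ h i (v i) - h i) * (v i).2.1 := by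
    intro v i
    have h0 := (hγ.trans_le (hτ (v i))).ne'
    have h1 : (transMatrix v *ᵥ h) i = ∑ j, (v i).1.1 j * h j := rfl
    rw [stageValue, sum_transProb_mul, mulVec_smul, Pi.smul_apply, Pi.smul_apply, h1, hcost,
      smul_eq_mul, smul_eq_mul]
    field_simp
    ring
  constructor
  · intro i v
    refine le_trans (le_of_eq ?_)
      (le_avgCostDT (r := g) hγ hT hB hu (fun j => by rw [hg]; linarith) v i)
    rw [avgCostDT_eq hγ hT]
    refine (tendsto_ratio (h := h) (transMatrixDT_mem hγ hT u) one_pos (fun _ => le_rfl)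
      (fun j => ?_) i).limsup_eq
    have h1 := hu.bellman_eq j
    rw [stageValue_eq_transMatrixDT, hg] at h1
    simp only [mul_one]
    linarith
  · intro i v
    have h1 : G.avgCost u i = g := by
      refine (tendsto_ratio (h := γ • h) (transMatrix_mem u) hγ (fun j => hτ (u j))
        (fun j => ?_) i).liminf_eq
      rw [hsm, ← hu.bellman_eq, hg, add_sub_cancel_right]
    rw [h1]
    refine le_liminf_ratio (B := B) (h := γ • h) (transMatrix_mem v) hγ (fun j => hτ (v j))
      (fun j => ?_) (fun j => ?_) i
    · rw [hcost]
      exact mul_le_mul_of_nonneg_right (abs_le.1 (hB j (v j))).2 (hγ.le.trans (hτ _))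
    · rw [hsm]
      have h2 := hu.bellman_le j (v j)
      rw [hg] at h2
      exact mul_le_mul_of_nonneg_right (by linarith) (hγ.le.trans (hτ _))

end MTDGame

/-! ### The discount sequence and its scalar recursion. -/

theorem viKappa_mem_Icc (t : ℕ) : viKappa t ∈ Set.Icc (0 : ℝ) 1 := by
  unfold viKappa
  split_ifs
  · norm_num
  · exact ⟨by positivity, (div_le_one (by positivity)).2 (by linarith)⟩

theorem viKappa_of_ne_zero {t : ℕ} (ht : t ≠ 0) : viKappa t = 1 - 1 / ((t : ℝ) + 1) := by
  rw [viKappa, if_neg ht]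
  field_simp
  ring

theorem viKappa_le_succ (t : ℕ) : viKappa t ≤ viKappa (t + 1) := by
  rcases eq_or_ne t 0 with rfl | ht
  · norm_num [viKappa]
  · rw [viKappa_of_ne_zero ht, viKappa_of_ne_zero t.succ_ne_zero]
    push_cast
    gcongr
    linarith

theorem tendsto_one_sub_viKappa_mul (R : ℝ) :
    Tendsto (fun t => (1 - viKappa t) * R) atTop (𝓝 0) := by
  have h : Tendsto (fun t : ℕ => 1 / ((t : ℝ) + 1) * R) atTop (𝓝 0) := by
    simpa using (tendsto_one_div_add_atTop_nhds_zero_nat (𝕜 := ℝ)).mul_const R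
  refine h.congr' ?_
  filter_upwards [eventually_ne_atTop 0] with t ht
  rw [viKappa_of_ne_zero ht, sub_sub_cancel]

/-- A nonnegative sequence with `a_{t+1} ≤ κ_{t+1} a_t + (κ_{t+1} - κ_t) R` tends to zero. -/
theorem tendsto_zero_of_le_viKappa {a : ℕ → ℝ} {R : ℝ} (h0 : ∀ t, 0 ≤ a t)
    (h : ∀ t, a (t + 1) ≤ viKappa (t + 1) * a t + (viKappa (t + 1) - viKappa t) * R) :
    Tendsto a atTop (𝓝 0) := by
  -- Since `κ_{t+2} = (t+2)/(t+3)`, multiplying the recursion by `t + 3` makes it telescope, with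
  -- increments `R/(t+2)`. The index starts at one because `κ_0 = 1/2` does not fit the formula for
  -- `κ_t`.
  have key : ∀ t : ℕ, ((t : ℝ) + 2) * a (t + 1)
      ≤ 2 * a 1 + R * ∑ k ∈ Finset.range t, 1 / ((k : ℝ) + 1 + 1) := by
    intro t
    induction t with
    | zero => simp
    | succ t ih =>
      have h1 := h (t + 1)
      rw [viKappa_of_ne_zero (Nat.succ_ne_zero _), viKappa_of_ne_zero (Nat.succ_ne_zero _)] at h1
      push_cast at h1
      have h2 : (0 : ℝ) ≤ (t : ℝ) + 1 + 2 := by positivity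
      have h3 := mul_le_mul_of_nonneg_left h1 h2
      have h4 : ((t : ℝ) + 1 + 2) * ((1 - 1 / ((t : ℝ) + 1 + 1 + 1)) * a (t + 1) +
          (1 - 1 / ((t : ℝ) + 1 + 1 + 1) - (1 - 1 / ((t : ℝ) + 1 + 1))) * R)
          = ((t : ℝ) + 2) * a (t + 1) + R * (1 / ((t : ℝ) + 1 + 1)) := by
        field_simp
        ring
      rw [Finset.sum_range_succ, mul_add]
      push_cast
      linarith
  have hc : Tendsto (fun k : ℕ => 1 / ((k : ℝ) + 1 + 1)) atTop (𝓝 0) := by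
    have := (tendsto_one_div_add_atTop_nhds_zero_nat (𝕜 := ℝ)).comp (tendsto_add_atTop_nat 1)
    exact this.congr fun k => by simp
  -- The harmonic terms tend to zero, hence so do their Cesàro means.
  have hlim := ((tendsto_inv_atTop_nhds_zero_nat (𝕜 := ℝ)).const_mul (2 * a 1)).add
    (hc.cesaro.const_mul R)
  rw [mul_zero, mul_zero, add_zero] at hlim
  rw [← tendsto_add_atTop_iff_nat 1]
  refine squeeze_zero' (Eventually.of_forall fun t => h0 _) ?_ hlim
  filter_upwards [eventually_gt_atTop 0] with t ht
  have ht' : (0 : ℝ) < t := Nat.cast_pos.2 ht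
  have h5 := key t
  have h6 : (t : ℝ) * a (t + 1) ≤ ((t : ℝ) + 2) * a (t + 1) :=
    mul_le_mul_of_nonneg_right (by linarith) (h0 _)
  have h7 : a (t + 1) = (t : ℝ)⁻¹ * (t * a (t + 1)) := by field_simp
  rw [h7]
  calc _ ≤ (t : ℝ)⁻¹ * (2 * a 1 + R * ∑ k ∈ Finset.range t, 1 / ((k : ℝ) + 1 + 1)) :=
        mul_le_mul_of_nonneg_left (h6.trans h5) (by positivity)
    _ = _ := by ring

theorem spanSeminorm_one_sub_viKappa_smul_le {S : Type*} [Fintype S] [Nonempty S]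
    {x : S → ℝ} {R : ℝ} (hx : spanSeminorm x ≤ R) (t : ℕ) :
    spanSeminorm ((1 - viKappa t) • x) ≤ (1 - viKappa t) * R :=
  have h := sub_nonneg.2 (viKappa_mem_Icc t).2
  (spanSeminorm_smul_le h x).trans (mul_le_mul_of_nonneg_left hx h)

/-! ### Convergence of value iteration and the optimality equation. -/

namespace MTDGame

variable {S L Att : Type*} [Fintype S] [DecidableEq S] [Nonempty S] [Fintype L] {T : Set ℝ}
  {γ : ℝ} {G : MTDGame S L Att}

theorem exists_spanSeminorm_valueIter_le (hγ : 0 < γ) (hT : ∀ τ ∈ T, γ ≤ τ) (hTne : T.Nonempty)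
    (hgr : ∀ V : S → ℝ, ∃ u : MTDPolicy S T, G.IsGreedy γ V u) {B : ℝ}
    (hB : ∀ i, ∀ x : MTDAction S T, |G.costRate i x| ≤ B) (V0 : S → ℝ) :
    ∃ R, ∀ t, spanSeminorm (G.valueIter T γ V0 t) ≤ R := by
  obtain ⟨τ, hτ⟩ := hTne
  have hτ0 : 0 < τ := hγ.trans_le (hT _ hτ)
  have hq : 0 < γ / τ := by positivity
  have hq1 : γ / τ ≤ 1 := (div_le_one hτ0).2 (hT _ hτ)
  -- The second entry is the fixed point of `r ↦ 2 * B + (1 - γ / τ) * r`, so the bound reproduces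
  -- itself.
  set R := max (spanSeminorm V0) (2 * B / (γ / τ)) with hR
  refine ⟨R, fun t => ?_⟩
  induction t with
  | zero => exact le_max_left _ _
  | succ t ih =>
    obtain ⟨hk0, hk1⟩ := viKappa_mem_Icc t
    have h1 := spanSeminorm_bellman_le hγ hT hτ hgr hB (viKappa t • G.valueIter T γ V0 t)
    have h2 : spanSeminorm (viKappa t • G.valueIter T γ V0 t) ≤ R :=
      ((spanSeminorm_smul_le hk0 _).trans
        (mul_le_of_le_one_left (spanSeminorm_nonneg _) hk1)).trans ih
    have h3 := mul_le_mul_of_nonneg_left h2 (sub_nonneg.2 hq1)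
    have h4 : 2 * B ≤ R * (γ / τ) := (div_le_iff₀ hq).1 (le_max_right _ _)
    rw [valueIter]
    linarith

/-- Nonexpansiveness compares consecutive updates; their arguments differ by the discounted old
difference plus a drift `(κ_{t+1} - κ_t) V^t` of bounded span, which is the scalar recursion above.
-/
theorem tendsto_spanSeminorm_valueIter_succ_sub (hγ : 0 < γ) (hT : ∀ τ ∈ T, γ ≤ τ)
    (hgr : ∀ V : S → ℝ, ∃ u : MTDPolicy S T, G.IsGreedy γ V u) {V0 : S → ℝ} {R : ℝ}
    (hR : ∀ t, spanSeminorm (G.valueIter T γ V0 t) ≤ R) :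
    Tendsto (fun t => spanSeminorm (G.valueIter T γ V0 (t + 1) - G.valueIter T γ V0 t))
      atTop (𝓝 0) := by
  refine tendsto_zero_of_le_viKappa (R := R) (fun t => spanSeminorm_nonneg _) fun t => ?_
  set V := G.valueIter T γ V0 with hV
  have hm : 0 ≤ viKappa (t + 1) - viKappa t := sub_nonneg.2 (viKappa_le_succ t)
  have h1 : viKappa (t + 1) • V (t + 1) - viKappa t • V t
      = viKappa (t + 1) • (V (t + 1) - V t) + (viKappa (t + 1) - viKappa t) • V t := by
    module
  calc spanSeminorm (V (t + 1 + 1) - V (t + 1))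
      ≤ spanSeminorm (viKappa (t + 1) • V (t + 1) - viKappa t • V t) :=
        spanSeminorm_bellman_sub_le hγ hT hgr _ _
    _ ≤ _ := by
      rw [h1]
      refine (spanSeminorm_add_le _ _).trans (add_le_add
        (spanSeminorm_smul_le (viKappa_mem_Icc _).1 _) ((spanSeminorm_smul_le hm _).trans ?_))
      exact mul_le_mul_of_nonneg_left (hR t) hm

/-- This residual concerns the policies computed in the updates; it differs from `V^{t+1} - V^t` by
`(1 - κ_t) V^t`, whose span vanishes. -/
theorem tendsto_spanSeminorm_bellman_viKappa_sub (hγ : 0 < γ) (hT : ∀ τ ∈ T, γ ≤ τ)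
    (hgr : ∀ V : S → ℝ, ∃ u : MTDPolicy S T, G.IsGreedy γ V u) {V0 : S → ℝ} {R : ℝ}
    (hR : ∀ t, spanSeminorm (G.valueIter T γ V0 t) ≤ R) :
    Tendsto (fun t => spanSeminorm (G.bellman T γ (viKappa t • G.valueIter T γ V0 t)
      - viKappa t • G.valueIter T γ V0 t)) atTop (𝓝 0) := by
  have hlim := (tendsto_spanSeminorm_valueIter_succ_sub hγ hT hgr hR).add
    (tendsto_one_sub_viKappa_mul R)
  rw [add_zero] at hlim
  refine squeeze_zero (fun t => spanSeminorm_nonneg _) (fun t => ?_) hlim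
  have h1 : G.bellman T γ (viKappa t • G.valueIter T γ V0 t) - viKappa t • G.valueIter T γ V0 t
      = (G.valueIter T γ V0 (t + 1) - G.valueIter T γ V0 t)
        + (1 - viKappa t) • G.valueIter T γ V0 t := by
    rw [valueIter]
    module
  rw [h1]
  exact (spanSeminorm_add_le _ _).trans
    (add_le_add le_rfl (spanSeminorm_one_sub_viKappa_smul_le (hR t) t))

theorem tendsto_spanSeminorm_bellman_valueIter_sub (hγ : 0 < γ) (hT : ∀ τ ∈ T, γ ≤ τ)
    (hgr : ∀ V : S → ℝ, ∃ u : MTDPolicy S T, G.IsGreedy γ V u) {V0 : S → ℝ} {R : ℝ}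
    (hR : ∀ t, spanSeminorm (G.valueIter T γ V0 t) ≤ R) :
    Tendsto (fun t => spanSeminorm (G.bellman T γ (G.valueIter T γ V0 t) - G.valueIter T γ V0 t))
      atTop (𝓝 0) := by
  have hlim := (tendsto_one_sub_viKappa_mul R).add
    (tendsto_spanSeminorm_valueIter_succ_sub hγ hT hgr hR)
  rw [add_zero] at hlim
  refine squeeze_zero (fun t => spanSeminorm_nonneg _) (fun t => ?_) hlim
  set V := G.valueIter T γ V0 with hV
  have h1 : G.bellman T γ (V t) - V t
      = (G.bellman T γ (V t) - G.bellman T γ (viKappa t • V t)) + (V (t + 1) - V t) := by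
    rw [hV, valueIter]
    module
  have h2 : V t - viKappa t • V t = (1 - viKappa t) • V t := by module
  rw [h1]
  refine (spanSeminorm_add_le _ _).trans (add_le_add ?_ le_rfl)
  refine (spanSeminorm_bellman_sub_le hγ hT hgr _ _).trans ?_
  rw [h2]
  exact spanSeminorm_one_sub_viKappa_smul_le (hR t) t

/-- The average cost optimality equation has a solution. -/
theorem exists_bellman_eq_add (hγ : 0 < γ) (hT : ∀ τ ∈ T, γ ≤ τ)
    (hgr : ∀ V : S → ℝ, ∃ u : MTDPolicy S T, G.IsGreedy γ V u) {V0 : S → ℝ} {R : ℝ}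
    (hR : ∀ t, spanSeminorm (G.valueIter T γ V0 t) ≤ R) :
    ∃ (h : S → ℝ) (g : ℝ), ∀ i, G.bellman T γ h i = g + h i := by
  have s := Classical.arbitrary S
  set V := G.valueIter T γ V0 with hV
  -- The iterates themselves may diverge; subtracting the value at `s` leaves the span unchanged and
  -- confines them to a compact cube.
  obtain ⟨h, -, φ, hφ, hlim⟩ := (isCompact_univ_pi fun _ : S =>
    isCompact_Icc (a := -R) (b := R)).tendsto_subseq (x := fun t i => V t i - V t s)
    (fun t i _ => by
      have h1 := (sub_le_spanSeminorm (V t) i s).trans (hR t)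
      have h2 := (sub_le_spanSeminorm (V t) s i).trans (hR t)
      exact ⟨by linarith, h1⟩)
  have hspan : spanSeminorm (G.bellman T γ h - h) ≤ 0 := by
    -- The factor 4: replacing `h` by an iterate costs `span (W - h)` twice, and a span is at most
    -- twice the sup norm.
    have hd := ((tendsto_iff_norm_sub_tendsto_zero.1 hlim).const_mul 4).add
      ((tendsto_spanSeminorm_bellman_valueIter_sub hγ hT hgr hR).comp hφ.tendsto_atTop)
    rw [mul_zero, add_zero] at hd
    refine ge_of_tendsto' hd fun n => ?_
    set W := V (φ n)
    have h1 : spanSeminorm (W - h) ≤ 2 * ‖(fun i => W i - W s) - h‖ := by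
      refine le_trans (spanSeminorm_le fun i j => ?_) (spanSeminorm_le_two_mul_norm _)
      have := sub_le_spanSeminorm ((fun i => W i - W s) - h) i j
      simp only [Pi.sub_apply] at this ⊢
      linarith
    have h2 : spanSeminorm (h - W) ≤ spanSeminorm (W - h) := spanSeminorm_le fun i j => by
      have := sub_le_spanSeminorm (W - h) j i
      simp only [Pi.sub_apply] at this ⊢
      linarith
    have h3 : G.bellman T γ h - h
        = (G.bellman T γ h - G.bellman T γ W) + ((G.bellman T γ W - W) + (W - h)) := by abel
    have h4 := spanSeminorm_add_le (G.bellman T γ h - G.bellman T γ W)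
      ((G.bellman T γ W - W) + (W - h))
    have h5 := spanSeminorm_add_le (G.bellman T γ W - W) (W - h)
    have h6 := spanSeminorm_bellman_sub_le hγ hT hgr h W
    rw [h3]
    simp only [Function.comp_apply]
    change _ ≤ 4 * ‖(fun i => W i - W s) - h‖ + spanSeminorm (G.bellman T γ W - W)
    linarith
  refine ⟨h, G.bellman T γ h s - h s, fun i => ?_⟩
  have h1 := (sub_le_spanSeminorm (G.bellman T γ h - h) i s).trans hspan
  have h2 := (sub_le_spanSeminorm (G.bellman T γ h - h) s i).trans hspan
  simp only [Pi.sub_apply] at h1 h2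
  linarith

end MTDGame

theorem theorem2 {S L Att : Type*} [Fintype S] [DecidableEq S] [Nonempty S] [Fintype L]
    (G : MTDGame S L Att)
    -- bounds on the defending period, and the set of admissible periods
    (τlo τhi : ℝ) (hτ : 0 < τlo) (T : Set ℝ) (hTsub : T ⊆ Set.Icc τlo τhi)
    (hTcpt : IsCompact T) (hTne : T.Nonempty)
    -- the parameter of the data transformation
    (γ : ℝ) (hγ0 : 0 < γ) (hγ1 : γ < τlo)
    -- the cost per unit of time is continuous and bounded on the action space of each state
    (hcont : ∀ i : S, Continuous fun x : MTDAction S T => G.costRate i x)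
    (hbdd : ∀ i : S, ∃ B : ℝ, ∀ x : MTDAction S T, |G.costRate i x| ≤ B) :
    -- an optimal stationary policy exists, for the transformed and for the original problem
    (∃ u : MTDPolicy S T, G.IsOptimalDT γ u ∧ G.IsOptimal u) ∧
    -- the minimum in the definition of `F` is attained
    (∀ V : S → ℝ, ∃ u : MTDPolicy S T, G.IsGreedy γ V u) ∧
    ∀ (V0 : S → ℝ) (ε : ℝ), 0 < ε →
      -- the policy found when the stopping condition is met is `ε`-optimal
      (∀ (t : ℕ) (u : MTDPolicy S T), G.IsGreedy γ (G.valueIter T γ V0 t) u →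
        spanSeminorm (G.bellman T γ (G.valueIter T γ V0 t) - G.valueIter T γ V0 t) < ε →
        G.IsEpsOptimalDT γ ε u) ∧
      -- the stopping condition is met after finitely many iterations, and from then on
      (∀ᶠ t in atTop,
        spanSeminorm (G.bellman T γ (G.valueIter T γ V0 t) - G.valueIter T γ V0 t) < ε) ∧
      -- so is the stopping test in terms of successive iterates
      (∀ᶠ t in atTop, spanSeminorm (G.valueIter T γ V0 (t + 1) - G.valueIter T γ V0 t) < ε) ∧
      -- the policies that attain the minima in the updates `V^{t+1} = F(κ_t V^t)` of the iteration
      -- are eventually `ε`-optimal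
      (∀ᶠ t in atTop, ∀ u : MTDPolicy S T,
        G.IsGreedy γ (viKappa t • G.valueIter T γ V0 t) u → G.IsEpsOptimalDT γ ε u) := by
  have hT : ∀ τ ∈ T, γ ≤ τ := fun τ h => hγ1.le.trans (hTsub h).1
  have hgr := G.exists_isGreedy hγ0 hT hTcpt hTne hcont
  obtain ⟨B, hB⟩ : ∃ B, ∀ i, ∀ x : MTDAction S T, |G.costRate i x| ≤ B := by
    choose b hb using hbdd
    exact ⟨⨆ i, b i, fun i x => (hb i x).trans (le_ciSup (Set.finite_range b).bddAbove i)⟩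
  have hspan := MTDGame.exists_spanSeminorm_valueIter_le hγ0 hT hTne hgr hB
  refine ⟨?_, hgr, fun V0 ε hε => ?_⟩
  -- Existence of an optimal policy uses value iteration from zero; any starting vector would do.
  · obtain ⟨R, hR⟩ := hspan 0
    obtain ⟨h, g, hg⟩ := MTDGame.exists_bellman_eq_add hγ0 hT hgr hR
    obtain ⟨u, hu⟩ := hgr h
    exact ⟨u, hu.isOptimal hγ0 hT hB hg⟩
  · obtain ⟨R, hR⟩ := hspan V0
    refine ⟨fun t u hu h => hu.isEpsOptimalDT hγ0 hT hB h.le,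
      (MTDGame.tendsto_spanSeminorm_bellman_valueIter_sub hγ0 hT hgr hR).eventually_lt_const hε,
      (MTDGame.tendsto_spanSeminorm_valueIter_succ_sub hγ0 hT hgr hR).eventually_lt_const hε, ?_⟩
    filter_upwards [(MTDGame.tendsto_spanSeminorm_bellman_viKappa_sub hγ0 hT hgr
      hR).eventually_lt_const hε] with t ht u hu
    exact hu.isEpsOptimalDT hγ0 hT hB ht.le
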